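/- Consider an exchange economy with consumers $i=1,\dots,N$ ($N\ge 1$) and goods $k=1,\dots,K$. Consumer $i$ has a utility function $u_i:\mathbb{R}^K_{\ge 0}\to[-\infty,\infty)$, finite at every point of $\mathbb{R}^K_{>0}$ and continuous on $\mathbb{R}^K_{\ge 0}$. Where it is finite, $u_i$ is strictly increasing (if $u_i(x)>-\infty$, $x\le y$ and $x\ne y$, then $u_i(x)<u_i(y)$), strictly concave, and differentiable in the sense that at every $x$ with $u_i(x)>-\infty$ the partial derivative $\partial u_i/\partial x_k$ exists for every $k$ with $x_k>0$. (In particular, $u_i$ may be any real-valued function that is strictly increasing, strictly concave and differentiable on $\mathbb{R}^K_{\ge 0}$.) Let $\omega_i\in\mathbb{R}^K_{>0}$ be arbitrary endowments and let $w=\sum_{i}\omega_i$. For a weight vector $\alpha\in\mathbb{R}^N_{>0}$, an allocation $x=(x_1,\dots,x_N)$ with $x_i\in\mathbb{R}^K_{\ge0}$ and $\sum_i x_i\le w$, and prices $p\in\mathbb{R}^K_{\ge 0}$, define the economy's potential $$Y_\alpha(x,p,w)=\sum_{i}\alpha_i u_i(x_i)-\Bigl(\langle p|w\rangle+\sum_i\alpha_i\,\overline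 v_i(p/\alpha_i)\Bigr),\qquad \overline v_i(q)=\sup_{y\in\mathbb{R}^K_{\ge0}}\bigl(u_i(y)-\langle q|y\rangle\bigr)\in(-\infty,\infty].$$ Then there is a weight vector $\alpha$ with $\alpha_i>0$ for all $i$ and $\sum_i\alpha_i=1$ such that $Y_\alpha(\cdot,\cdot,w)$ has exactly one root $(x,p)$ among the feasible allocations and nonnegative prices, and this root is a Walrasian equilibrium for the endowments $\omega_1,\dots,\omega_N$: for every $i$ the bundle $x_i$ maximizes $u_i$ over $\{y\in\mathbb{R}^K_{\ge0}:\langle p|y\rangle\le\langle p|\omega_i\rangle\}$, and $\sum_i x_i=\sum_i\omega_i$. -/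

import Mathlib

/-- The standing assumptions on a utility function `u` on the nonnegative orthant of `ℝ^K`
(values outside the orthant are irrelevant). The value `⊥ = -∞` is allowed on the boundary of
the orthant, so that Cobb–Douglas and CES utilities are included. A real-valued function that is
strictly increasing, strictly concave and differentiable on the orthant is a special case. -/
structure IsUtility {K : ℕ} (u : (Fin K → ℝ) → EReal) : Prop where
  /-- no bundle has infinite positive utility -/
  lt_top : ∀ x, 0 ≤ x → u x < ⊤
  /-- bundles containing a positive amount of every good have finite utility -/
  finite_of_pos : ∀ x, (∀ k, 0 < x k) → ⊥ < u x
  /-- continuity on the orthant, for the order topology on the extended reals -/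
  continuousOn : ContinuousOn u {x | 0 ≤ x}
  /-- strictly increasing (in the product order) wherever finite -/
  strictlyIncreasing : ∀ x y, 0 ≤ x → ⊥ < u x → x < y → u x < u y
  /-- strictly concave wherever finite -/
  strictlyConcave : ∀ x y, 0 ≤ x → 0 ≤ y → ⊥ < u x → ⊥ < u y → x ≠ y →
    ∀ a b : ℝ, 0 < a → 0 < b → a + b = 1 →
      (a : EReal) * u x + (b : EReal) * u y < u (a • x + b • y)
  /-- wherever `u` is finite, its partial derivative exists in every good consumed in a positive
  amount (`u` is finite near `x` on the line considered, by continuity). At interior points this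
  is differentiability, since `u` is concave; marginal utility may be infinite at zero
  consumption. -/
  differentiable : ∀ x, 0 ≤ x → ⊥ < u x → ∀ k, 0 < x k →
    DifferentiableAt ℝ (fun t : ℝ => (u (Function.update x k t)).toReal) (x k)

/-- The total amounts `w_k = ∑ i, ω_{ik}` of the goods. -/
def totalEndowment {N K : ℕ} (ω : Fin N → Fin K → ℝ) : Fin K → ℝ :=
  ∑ i, ω i

/-- The set `F(w)` of feasible allocations. -/
def feasible {N K : ℕ} (w : Fin K → ℝ) : Set (Fin N → Fin K → ℝ) :=
  {x | (∀ i, 0 ≤ x i) ∧ ∀ k, ∑ i, x i k ≤ w k}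

/-- The Fenchel dual `sup_{x ≥ 0} (u(x) - ⟨p|x⟩)`, with values in the extended reals. -/
noncomputable def fenchelDual {K : ℕ} (u : (Fin K → ℝ) → EReal) (p : Fin K → ℝ) : EReal :=
  ⨆ x ∈ {x : Fin K → ℝ | 0 ≤ x}, (u x - ((p ⬝ᵥ x : ℝ) : EReal))

/-- Weighted aggregate utility `U_α(x)`. -/
noncomputable def weightedUtility {N K : ℕ} (u : Fin N → (Fin K → ℝ) → EReal) (α : Fin N → ℝ)
    (x : Fin N → Fin K → ℝ) : EReal :=
  ∑ i, (α i : EReal) * u i (x i)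

/-- The dual objective `V_α(p, w) = ⟨p|w⟩ + ∑ i, α_i v̄_i(p / α_i)`, for positive weights. -/
noncomputable def dualWelfare {N K : ℕ} (u : Fin N → (Fin K → ℝ) → EReal) (α : Fin N → ℝ)
    (p w : Fin K → ℝ) : EReal :=
  ((p ⬝ᵥ w : ℝ) : EReal) + ∑ i, (α i : EReal) * fenchelDual (u i) ((α i)⁻¹ • p)

/-- The economy's potential `Y_α(x, p, w) = U_α(x) - V_α(p, w)`. -/
noncomputable def potential {N K : ℕ} (u : Fin N → (Fin K → ℝ) → EReal) (α : Fin N → ℝ)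
    (x : Fin N → Fin K → ℝ) (p w : Fin K → ℝ) : EReal :=
  weightedUtility u α x - dualWelfare u α p w

/-- `(x, p)` is a root of the potential `Y_α(·, ·, w)`, whose arguments are the feasible
allocations and the nonnegative price vectors. -/
def IsPotentialRoot {N K : ℕ} (u : Fin N → (Fin K → ℝ) → EReal) (α : Fin N → ℝ)
    (w : Fin K → ℝ) (x : Fin N → Fin K → ℝ) (p : Fin K → ℝ) : Prop :=
  x ∈ feasible w ∧ 0 ≤ p ∧ potential u α x p w = 0

/-- `(x, p)` is a Walrasian equilibrium for the endowments `ω`: prices are nonnegative, every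
consumer's bundle maximizes her utility over her budget set at income `⟨p|ω_i⟩`, and all markets
clear. -/
structure IsWalrasianEquilibrium {N K : ℕ} (u : Fin N → (Fin K → ℝ) → EReal)
    (ω : Fin N → Fin K → ℝ) (x : Fin N → Fin K → ℝ) (p : Fin K → ℝ) : Prop where
  price_nonneg : 0 ≤ p
  bundle_nonneg : ∀ i, 0 ≤ x i
  budget : ∀ i, p ⬝ᵥ x i ≤ p ⬝ᵥ ω i
  optimal : ∀ i (y : Fin K → ℝ), 0 ≤ y → p ⬝ᵥ y ≤ p ⬝ᵥ ω i → u i y ≤ u i (x i)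
  market_clearing : ∑ i, x i = totalEndowment ω

/-!
Scarf's combinatorial lemma yields a covering lemma for the standard simplex, which takes the place
of Brouwer's fixed point theorem: it gives prices clearing the excess demands of the consumers,
whose bundles are first restricted to a box, where demand is continuous; the box does not bind, so
by concavity it is harmless. At the equilibrium each consumer has a positive marginal utility of
income `l i`, and with weights `α i` proportional to `1 / l i` the equilibrium prices, suitably
scaled, support the bundles of all consumers at once.

Up to sign, the potential is the value of the unsold goods plus the gaps in the Fenchel–Young
inequalities of the consumers, all of them nonnegative; its roots are the pairs at which all gaps
close. Hence the equilibrium is a root. Weak duality makes the set of roots a product of a set of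
allocations with a set of price vectors, so uniqueness can be checked in each factor: strict
concavity determines the allocation, and the first-order condition of a consumer who consumes good
`k` determines the price of good `k`.
-/

section Scarf

variable {I V L : Type*} [LinearOrder L]

/-- The dominant sets of Scarf's lemma: no point of `V` has, in every coordinate `f i`, a larger
value than all points of `σ`. -/
def Dominant (f : I → V → L) (σ : Finset V) : Prop :=
  ∀ y, ∃ i, ∀ x ∈ σ, f i y ≤ f i x

/-- A choice, for every coordinate `f i`, of a point of `σ` at which it is least. -/
structure IsMinimizers (f : I → V → L) (σ : Finset V) (m : I → V) : Prop where
  mem : ∀ i, m i ∈ σ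
  le : ∀ i, ∀ x ∈ σ, f i (m i) ≤ f i x

/-- The points that can replace the minimizer `m a` in a pivot step of Scarf's algorithm: among the
points exceeding `m i` in every other coordinate `f i`, those with the largest value of `f a`. -/
structure IsReplacement (f : I → V → L) (m : I → V) (a : I) (x : V) : Prop where
  lt : ∀ i, i ≠ a → f i (m i) < f i x
  max : ∀ y, (∀ i, i ≠ a → f i (m i) < f i y) → f a y ≤ f a x

/-- The slack points of Scarf's lemma, which play the role of the vertices of a simplex: `s i` is
the least point in coordinate `f i` and lies above all other points in the other coordinates. -/
structure IsSlack (f : I → V → L) (s : I → V) : Prop where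
  lt : ∀ i v, v ≠ s i → f i (s i) < f i v
  gt : ∀ v, v ∉ Set.range s → ∀ i j, i ≠ j → f i v < f i (s j)

theorem Dominant.mono {f : I → V → L} {σ τ : Finset V} (h : Dominant f σ) (hτ : τ ⊆ σ) :
    Dominant f τ := fun y =>
  (h y).imp fun _ hi x hx => hi x (hτ hx)

theorem exists_isMinimizers (f : I → V → L) {σ : Finset V} (hσ : σ.Nonempty) :
    ∃ m, IsMinimizers f σ m := by
  choose m hm hle using fun i => σ.exists_min_image (f i) hσ
  exact ⟨m, hm, hle⟩

theorem IsSlack.le {f : I → V → L} {s : I → V} (hs : IsSlack f s) (i : I) (v : V) :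
    f i (s i) ≤ f i v := by
  rcases eq_or_ne v (s i) with rfl | hv
  · exact le_rfl
  · exact (hs.lt i v hv).le

theorem image_erase_eq_image [DecidableEq I] [DecidableEq V] {c : V → I} {σ : Finset V} {v w : V}
    (hv : v ∈ σ) (hvw : v ≠ w) (hc : c v = c w) : (σ.erase w).image c = σ.image c := by
  by_cases hw : w ∈ σ
  · conv_rhs => rw [← Finset.insert_erase hw, Finset.image_insert, ← hc]
    exact (Finset.insert_eq_of_mem <|
      Finset.mem_image_of_mem c (Finset.mem_erase.2 ⟨hvw, hv⟩)).symm
  · rw [Finset.erase_eq_of_notMem hw]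

section Pivot

variable {f : I → V → L} {σ τ : Finset V} {m : I → V} {a b : I} {x y : V}

theorem IsReplacement.unique (hf : ∀ i, Function.Injective (f i)) (hx : IsReplacement f m a x)
    (hy : IsReplacement f m a y) : x = y :=
  hf a (le_antisymm (hy.max x hx.lt) (hx.max y hy.lt))

theorem exists_isReplacement [Finite V] (hy : ∀ i, i ≠ a → f i (m i) < f i y) :
    ∃ x, IsReplacement f m a x := by
  obtain ⟨x, hx, hmax⟩ := (Set.toFinite {y | ∀ i, i ≠ a → f i (m i) < f i y}).exists_maximalFor
    (f a) _ ⟨y, hy⟩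
  exact ⟨x, hx, fun z hz => (le_total _ _).elim id fun h => hmax hz h⟩

theorem IsMinimizers.not_forall_lt (hm : IsMinimizers f τ m) (hτ : Dominant f τ) (x : V) :
    ¬ ∀ i, f i (m i) < f i x := fun h => by
  obtain ⟨i, hi⟩ := hτ x
  exact (h i).not_ge (hi _ (hm.mem i))

theorem IsReplacement.le_of_mem (hm : IsMinimizers f τ m) (hτ : Dominant f τ)
    (hx : IsReplacement f m a x) (hy : y ∈ τ) : f a x ≤ f a y := by
  obtain ⟨i, hi⟩ := hτ x
  obtain rfl : i = a := by
    by_contra hia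
    exact (hx.lt i hia).not_ge (hi _ (hm.mem i))
  exact hi y hy

theorem IsReplacement.ne (hm : IsMinimizers f τ m) (hτ : Dominant f τ) (hab : a ≠ b)
    (hx : IsReplacement f m a x) (hy : IsReplacement f m b y) : x ≠ y := by
  rintro rfl
  refine hm.not_forall_lt hτ x fun i => ?_
  rcases eq_or_ne i a with rfl | hia
  · exact hy.lt i hab
  · exact hx.lt i hia

variable [DecidableEq V]

theorem IsReplacement.dominant_insert (hm : IsMinimizers f τ m) (hτ : Dominant f τ)
    (hx : IsReplacement f m a x) : Dominant f (insert x τ) := by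
  intro y
  by_cases hy : ∀ i, i ≠ a → f i (m i) < f i y
  · refine ⟨a, Finset.forall_mem_insert _ _ _ |>.2 ⟨hx.max y hy, fun z hz => ?_⟩⟩
    exact (hx.max y hy).trans (hx.le_of_mem hm hτ hz)
  · push Not at hy
    obtain ⟨i, hia, hi⟩ := hy
    exact ⟨i, Finset.forall_mem_insert _ _ _ |>.2
      ⟨hi.trans (hx.lt i hia).le, fun z hz => hi.trans (hm.le i z hz)⟩⟩

variable [Fintype I]

theorem IsMinimizers.image_eq (hf : ∀ i, Function.Injective (f i)) (hm : IsMinimizers f σ m)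
    (hσ : Dominant f σ) : Finset.univ.image m = σ := by
  refine Finset.Subset.antisymm (Finset.image_subset_iff.2 fun i _ => hm.mem i) fun x hx => ?_
  obtain ⟨i, hi⟩ := hσ x
  have hmi : m i = x := hf i (le_antisymm (hm.le i x hx) (hi _ (hm.mem i)))
  exact hmi ▸ Finset.mem_image_of_mem m (Finset.mem_univ i)

theorem IsReplacement.notMem (himg : Finset.univ.image m = τ) (hab : a ≠ b) (hmab : m a = m b)
    (hx : IsReplacement f m a x) : x ∉ τ := by
  subst himg
  simp only [Finset.mem_image, Finset.mem_univ, true_and, not_exists]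
  rintro i rfl
  rcases eq_or_ne i a with rfl | hia
  · exact (hx.lt b hab.symm).ne (congrArg (f b) hmab.symm)
  · exact (hx.lt i hia).false

theorem isReplacement_or_of_dominant_insert (hf : ∀ i, Function.Injective (f i))
    (hm : IsMinimizers f τ m) (hcard : τ.card + 1 = Fintype.card I) (hab : a ≠ b)
    (hmab : m a = m b) (hx : x ∉ τ) (hd : Dominant f (insert x τ)) :
    IsReplacement f m a x ∨ IsReplacement f m b x := by
  obtain ⟨m', hm'⟩ := exists_isMinimizers f (Finset.insert_nonempty x τ)
  have himg := hm'.image_eq hf hd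
  have hinj : Function.Injective m' := by
    refine Set.injOn_univ.1 (Finset.coe_univ (α := I) ▸ Finset.card_image_iff.1 ?_)
    rw [himg, Finset.card_insert_of_notMem hx, hcard, Finset.card_univ]
  obtain ⟨j, -, hj⟩ := Finset.mem_image.1 (himg ▸ Finset.mem_insert_self x τ)
  have heq : ∀ i, i ≠ j → m' i = m i := fun i hi => by
    have hmem : m' i ∈ τ := Finset.mem_of_mem_insert_of_ne (hm'.mem i) fun h =>
      hi (hinj (h.trans hj.symm))
    exact hf i (le_antisymm (hm'.le i _ (Finset.mem_insert_of_mem (hm.mem i))) (hm.le i _ hmem))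
  have hrep : IsReplacement f m j x := by
    refine ⟨fun i hi => ?_, fun y hy => ?_⟩
    · refine lt_of_le_of_ne ?_ fun h => hx (hf i h ▸ hm.mem i)
      rw [← heq i hi]
      exact hm'.le i x (Finset.mem_insert_self _ _)
    · obtain ⟨i, hi⟩ := hd y
      obtain rfl : i = j := by
        by_contra hij
        exact (hy i hij).not_ge (hi _ (Finset.mem_insert_of_mem (hm.mem i)))
      exact hi x (Finset.mem_insert_self _ _)
  by_cases ha : a = j
  · exact Or.inl (ha ▸ hrep)
  by_cases hb : b = j
  · exact Or.inr (hb ▸ hrep)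
  · exact absurd (hinj ((heq a ha).trans (hmab.trans (heq b hb).symm))) hab

end Pivot

section Parity

variable [Fintype I] {f : I → V → L} {σ τ : Finset V} {s : I → V} {c : V → I} {i₀ : I}

theorem IsSlack.dominant_insert [DecidableEq V] [DecidableEq I] (hs : IsSlack f s) {x : V}
    (hx : x ∉ (Finset.univ.erase i₀).image s)
    (hmax : ∀ y ∉ (Finset.univ.erase i₀).image s, f i₀ y ≤ f i₀ x) :
    Dominant f (insert x ((Finset.univ.erase i₀).image s)) := by
  intro y
  by_cases hy : y ∈ (Finset.univ.erase i₀).image s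
  · obtain ⟨i, -, rfl⟩ := Finset.mem_image.1 hy
    exact ⟨i, fun v _ => hs.le i v⟩
  refine ⟨i₀, Finset.forall_mem_insert _ _ _ |>.2 ⟨hmax y hy, fun v hv => (hmax y hy).trans ?_⟩⟩
  obtain ⟨j, hj, rfl⟩ := Finset.mem_image.1 hv
  by_cases hxs : x ∈ Set.range s
  · obtain ⟨i, rfl⟩ := hxs
    obtain rfl : i = i₀ := by
      by_contra hi
      exact hx (Finset.mem_image_of_mem s (Finset.mem_erase.2 ⟨hi, Finset.mem_univ i⟩))
    exact hs.le i _
  · exact (hs.gt x hxs i₀ j (Finset.ne_of_mem_erase hj).symm).le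

variable [Fintype V]

open Classical in
/-- The rooms of Scarf's parity argument: the dominant sets with one point for each coordinate. -/
noncomputable def rooms (f : I → V → L) : Finset (Finset V) :=
  Finset.univ.filter fun σ => Dominant f σ ∧ σ.card = Fintype.card I

theorem mem_rooms : σ ∈ rooms f ↔ Dominant f σ ∧ σ.card = Fintype.card I := by
  simp only [rooms, Finset.mem_filter, Finset.mem_univ, true_and]

theorem mem_rooms_and_subset_iff [DecidableEq V] (hcard : τ.card + 1 = Fintype.card I) :
    σ ∈ rooms f ∧ τ ⊆ σ ↔ ∃ x ∉ τ, Dominant f (insert x τ) ∧ insert x τ = σ := by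
  rw [mem_rooms, ← hcard, and_assoc, and_comm (a := _ = _), eq_comm (a := σ.card),
    ← Finset.exists_eq_insert_iff]
  constructor
  · rintro ⟨hσ, x, hx, rfl⟩
    exact ⟨x, hx, hσ, rfl⟩
  · rintro ⟨x, hx, hσ, rfl⟩
    exact ⟨hσ, x, hx, rfl⟩

theorem IsSlack.card_filter_rooms_eq_two [DecidableEq V] (hs : IsSlack f s)
    (hf : ∀ i, Function.Injective (f i)) (hτ : Dominant f τ) (hcard : τ.card + 1 = Fintype.card I)
    {t : V} (ht : t ∈ τ) (hts : t ∉ Set.range s) : ((rooms f).filter (τ ⊆ ·)).card = 2 := by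
  obtain ⟨m, hm⟩ := exists_isMinimizers f ⟨t, ht⟩
  have himg := hm.image_eq hf hτ
  obtain ⟨a, -, b, -, hab, hmab⟩ := Finset.exists_ne_map_eq_of_card_lt_of_maps_to
    (s := Finset.univ) (t := τ) (by rw [Finset.card_univ]; lia) fun i _ => hm.mem i
  have hex : ∀ j, ∃ x, IsReplacement f m j x := fun j =>
    exists_isReplacement (y := s j) fun i hij => (hm.le i t ht).trans_lt (hs.gt t hts i j hij)
  obtain ⟨x, hx⟩ := hex a
  obtain ⟨y, hy⟩ := hex b
  have hxτ := hx.notMem himg hab hmab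
  have hyτ := hy.notMem himg hab.symm hmab.symm
  refine Finset.card_eq_two.2 ⟨insert x τ, insert y τ, fun h => hx.ne hm hτ hab hy ?_, ?_⟩
  · exact (Finset.mem_insert.1 (h ▸ Finset.mem_insert_self x τ)).resolve_right hxτ
  ext σ
  rw [Finset.mem_filter, mem_rooms_and_subset_iff hcard, Finset.mem_insert, Finset.mem_singleton]
  constructor
  · rintro ⟨z, hz, hd, rfl⟩
    exact (isReplacement_or_of_dominant_insert hf hm hcard hab hmab hz hd).imp
      (fun h => by rw [h.unique hf hx]) fun h => by rw [h.unique hf hy]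
  · rintro (rfl | rfl)
    · exact ⟨x, hxτ, hx.dominant_insert hm hτ, rfl⟩
    · exact ⟨y, hyτ, hy.dominant_insert hm hτ, rfl⟩

variable [DecidableEq I]

open Classical in
/-- The doors of Scarf's parity argument: the dominant sets with one point fewer than a room, which
carry under `c` exactly the colours other than `i₀`. -/
noncomputable def doors (f : I → V → L) (c : V → I) (i₀ : I) : Finset (Finset V) :=
  Finset.univ.filter fun τ =>
    Dominant f τ ∧ τ.card + 1 = Fintype.card I ∧ τ.image c = Finset.univ.erase i₀

theorem mem_doors : τ ∈ doors f c i₀ ↔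
    Dominant f τ ∧ τ.card + 1 = Fintype.card I ∧ τ.image c = Finset.univ.erase i₀ := by
  simp only [doors, Finset.mem_filter, Finset.mem_univ, true_and]

theorem injOn_of_mem_doors (hτ : τ ∈ doors f c i₀) : Set.InjOn c τ := by
  obtain ⟨-, hcard, himg⟩ := mem_doors.1 hτ
  have hcompl := Finset.card_erase_add_one (Finset.mem_univ i₀)
  rw [Finset.card_univ] at hcompl
  rw [← Finset.card_image_iff, himg]
  lia

variable [DecidableEq V]

theorem IsSlack.card_filter_rooms_eq_one (hs : IsSlack f s) (hf : ∀ i, Function.Injective (f i))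
    (hinj : Function.Injective s) :
    ((rooms f).filter ((Finset.univ.erase i₀).image s ⊆ ·)).card = 1 := by
  have hcard : ((Finset.univ.erase i₀).image s).card + 1 = Fintype.card I := by
    rw [Finset.card_image_of_injective _ hinj, Finset.card_erase_add_one (Finset.mem_univ _),
      Finset.card_univ]
  have h0 : s i₀ ∉ (Finset.univ.erase i₀).image s := by
    simp only [Finset.mem_image, hinj.eq_iff, exists_eq_right, Finset.notMem_erase,
      not_false_eq_true]
  obtain ⟨x, hx, hmax⟩ := ((Finset.univ.erase i₀).image s)ᶜ.exists_max_image (f i₀)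
    ⟨s i₀, Finset.mem_compl.2 h0⟩
  simp only [Finset.mem_compl] at hx hmax
  refine Finset.card_eq_one.2 ⟨insert x ((Finset.univ.erase i₀).image s), ?_⟩
  ext σ
  rw [Finset.mem_filter, mem_rooms_and_subset_iff hcard, Finset.mem_singleton]
  refine ⟨?_, fun h => ⟨x, hx, hs.dominant_insert hx hmax, h.symm⟩⟩
  rintro ⟨z, hz, hd, rfl⟩
  obtain ⟨i, hi⟩ := hd x
  obtain rfl : i = i₀ := by
    by_contra hii
    have hsi : s i ∈ (Finset.univ.erase i₀).image s :=
      Finset.mem_image_of_mem s (Finset.mem_erase.2 ⟨hii, Finset.mem_univ i⟩)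
    have hxs := hf i (le_antisymm (hi _ (Finset.mem_insert_of_mem hsi)) (hs.le i x))
    exact hx (hxs ▸ hsi)
  rw [hf i (le_antisymm (hmax z hz) (hi z (Finset.mem_insert_self _ _)))]

theorem exists_erase_eq_of_mem_doors (hσ : σ ∈ rooms f) (hτ : τ ∈ doors f c i₀) (h : τ ⊆ σ) :
    ∃ z ∈ σ, σ.erase z = τ := by
  obtain ⟨z, hz, rfl⟩ := Finset.exists_eq_insert_iff.2
    ⟨h, (mem_doors.1 hτ).2.1.trans (mem_rooms.1 hσ).2.symm⟩
  exact ⟨z, Finset.mem_insert_self z τ, Finset.erase_insert hz⟩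

theorem erase_mem_doors {z : V} (hσ : σ ∈ rooms f) (hz : z ∈ σ)
    (h : (σ.erase z).image c = Finset.univ.erase i₀) : σ.erase z ∈ doors f c i₀ := by
  obtain ⟨hd, hcard⟩ := mem_rooms.1 hσ
  exact mem_doors.2
    ⟨hd.mono (Finset.erase_subset z σ), (Finset.card_erase_add_one hz).trans hcard, h⟩

theorem even_card_filter_doors (hσ : σ ∈ rooms f) (hc : σ.image c ≠ Finset.univ) :
    Even ((doors f c i₀).filter (· ⊆ σ)).card := by
  rcases ((doors f c i₀).filter (· ⊆ σ)).eq_empty_or_nonempty with h | ⟨τ, hτ⟩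
  · simp only [h, Finset.card_empty, Even.zero]
  obtain ⟨hτ, hτσ⟩ := Finset.mem_filter.1 hτ
  obtain ⟨x, hx, rfl⟩ := exists_erase_eq_of_mem_doors hσ hτ hτσ
  obtain ⟨-, -, himg⟩ := mem_doors.1 hτ
  have hcx : c x ≠ i₀ := by
    rintro rfl
    refine hc ?_
    rw [← Finset.insert_erase hx, Finset.image_insert, himg,
      Finset.insert_erase (Finset.mem_univ _)]
  obtain ⟨y, hy, hyx⟩ : ∃ y ∈ σ.erase x, c y = c x := by
    rw [← Finset.mem_image, himg]
    exact Finset.mem_erase.2 ⟨hcx, Finset.mem_univ _⟩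
  obtain ⟨hne, hyσ⟩ := Finset.mem_erase.1 hy
  have himgy : (σ.erase y).image c = Finset.univ.erase i₀ := by
    rw [image_erase_eq_image hx hne.symm hyx.symm, ← image_erase_eq_image hyσ hne hyx, himg]
  have hpair : (doors f c i₀).filter (· ⊆ σ) = {σ.erase x, σ.erase y} := by
    ext τ
    rw [Finset.mem_filter, Finset.mem_insert, Finset.mem_singleton]
    constructor
    · rintro ⟨hτ', hsub⟩
      obtain ⟨z, -, rfl⟩ := exists_erase_eq_of_mem_doors hσ hτ' hsub
      by_contra! hz
      have hxz : x ≠ z := fun h => hz.1 (h ▸ rfl)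
      have hyz : y ≠ z := fun h => hz.2 (h ▸ rfl)
      exact hne (injOn_of_mem_doors hτ' (Finset.mem_erase.2 ⟨hyz, hyσ⟩)
        (Finset.mem_erase.2 ⟨hxz, hx⟩) hyx)
    · rintro (rfl | rfl)
      · exact ⟨hτ, hτσ⟩
      · exact ⟨erase_mem_doors hσ hyσ himgy, Finset.erase_subset y σ⟩
  rw [hpair, Finset.card_pair fun h => hne.symm (Finset.erase_injOn σ hx hyσ h)]
  exact even_two

theorem IsSlack.image_mem_doors (hs : IsSlack f s) (hf : ∀ i, Function.Injective (f i))
    (hc : ∀ i, c (s i) = i) : (Finset.univ.erase i₀).image s ∈ doors f c i₀ := by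
  have hinj : Function.Injective s := Function.LeftInverse.injective hc
  have hne := Finset.card_pos.1 ((hs.card_filter_rooms_eq_one (i₀ := i₀) hf hinj).symm ▸ one_pos)
  obtain ⟨σ, hσ⟩ := hne
  obtain ⟨hσ, hsub⟩ := Finset.mem_filter.1 hσ
  refine mem_doors.2 ⟨(mem_rooms.1 hσ).1.mono hsub, ?_, ?_⟩
  · rw [Finset.card_image_of_injective _ hinj, Finset.card_erase_add_one (Finset.mem_univ _),
      Finset.card_univ]
  · rw [Finset.image_image, show c ∘ s = id from funext hc, Finset.image_id]

theorem eq_image_of_mem_doors (hτ : τ ∈ doors f c i₀) (hc : ∀ i, c (s i) = i)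
    (hsub : ∀ v ∈ τ, v ∈ Set.range s) : τ = (Finset.univ.erase i₀).image s := by
  obtain ⟨-, -, himg⟩ := mem_doors.1 hτ
  rw [← himg, Finset.image_image]
  conv_lhs => rw [← Finset.image_id (s := τ)]
  refine Finset.image_congr fun v hv => ?_
  obtain ⟨i, rfl⟩ := hsub v hv
  rw [Function.comp_apply, hc, id]

end Parity

theorem IsSlack.exists_dominant_image_eq_univ [Fintype I] [DecidableEq I] [Nonempty I] [Finite V]
    {f : I → V → L} {s : I → V} {c : V → I} (hs : IsSlack f s)
    (hf : ∀ i, Function.Injective (f i)) (hc : ∀ i, c (s i) = i) :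
    ∃ σ, Dominant f σ ∧ σ.image c = Finset.univ := by
  classical
  cases nonempty_fintype V
  by_contra! hno
  obtain ⟨i₀⟩ := ‹Nonempty I›
  have hcount := Finset.sum_card_bipartiteAbove_eq_sum_card_bipartiteBelow (s := doors f c i₀)
    (t := rooms f) (· ⊆ ·)
  have hrooms : Even (∑ σ ∈ rooms f, ((doors f c i₀).filter (· ⊆ σ)).card) :=
    Finset.even_sum _ fun σ hσ => even_card_filter_doors hσ (hno σ (mem_rooms.1 hσ).1)
  have hdoors : Even (∑ τ ∈ (doors f c i₀).erase ((Finset.univ.erase i₀).image s),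
      ((rooms f).filter (τ ⊆ ·)).card) := by
    refine Finset.even_sum _ fun τ hτ => ?_
    obtain ⟨hne, hτ⟩ := Finset.mem_erase.1 hτ
    obtain ⟨t, ht, hts⟩ : ∃ t ∈ τ, t ∉ Set.range s := by
      by_contra! hsub
      exact hne (eq_image_of_mem_doors hτ hc hsub)
    obtain ⟨hd, hcard, -⟩ := mem_doors.1 hτ
    rw [hs.card_filter_rooms_eq_two hf hd hcard ht hts]
    exact even_two
  have hone := hs.card_filter_rooms_eq_one (i₀ := i₀) hf (Function.LeftInverse.injective hc)
  simp only [Finset.bipartiteAbove, Finset.bipartiteBelow] at hcount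
  rw [← hcount, ← Finset.add_sum_erase _ _ (hs.image_mem_doors hf hc), hone, Nat.even_add] at hrooms
  exact Nat.not_even_one (hrooms.2 hdoors)

/-- Scarf's lemma, with ties allowed and the slack points removed. -/
theorem exists_forall_exists_mem_forall_le {G : Type*} [Finite I] [Nonempty I] [Finite G]
    (g : I → G → L) (c : G → I) :
    ∃ σ : Finset G, ∀ y, ∃ x₀ ∈ σ, ∀ x ∈ σ, g (c x₀) y ≤ g (c x₀) x := by
  classical
  cases nonempty_fintype I
  cases nonempty_fintype G
  let h : I → G ⊕ I → WithBot (WithTop L) := fun i =>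
    Sum.elim (fun x => ((g i x : WithTop L) : WithBot (WithTop L)))
      fun j => if j = i then ⊥ else ((⊤ : WithTop L) : WithBot (WithTop L))
  let f : I → G ⊕ I → WithBot (WithTop L) ×ₗ Fin (Fintype.card (G ⊕ I)) := fun i v =>
    toLex (h i v, Fintype.equivFin _ v)
  have hf : ∀ i, Function.Injective (f i) := fun i v w hvw =>
    (Fintype.equivFin _).injective (Prod.ext_iff.1 (toLex.injective hvw)).2
  have hlt : ∀ i v w, h i v < h i w → f i v < f i w := fun i v w hvw =>
    Prod.Lex.toLex_lt_toLex.2 (Or.inl hvw)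
  have hs : IsSlack f Sum.inr := by
    refine ⟨fun i v hv => hlt _ _ _ ?_, fun v hv i j hij => hlt _ _ _ ?_⟩
    · rcases v with x | j
      · simp [h]
      · have hji : j ≠ i := fun hji => hv (congrArg Sum.inr hji)
        simp [h, hji]
    · rcases v with x | k
      · simpa [h, hij.symm] using WithBot.coe_lt_coe.2 (WithTop.coe_lt_top (g i x))
      · exact absurd ⟨k, rfl⟩ hv
  obtain ⟨σ, hσ, hσc⟩ := hs.exists_dominant_image_eq_univ (c := Sum.elim c id) hf fun _ => rfl
  refine ⟨σ.toLeft, fun y => ?_⟩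
  obtain ⟨i, hi⟩ := hσ (Sum.inl y)
  have hi' : ∀ v ∈ σ, h i (Sum.inl y) ≤ h i v := fun v hv =>
    not_lt.1 fun hvy => (hlt i _ _ hvy).not_ge (hi v hv)
  obtain ⟨v, hv, rfl⟩ := Finset.mem_image.1 (hσc ▸ Finset.mem_univ i)
  rcases v with x₀ | j
  · refine ⟨x₀, Finset.mem_toLeft.2 hv, fun x hx => ?_⟩
    simpa [h] using hi' _ (Finset.mem_toLeft.1 hx)
  · exact absurd (hi' _ hv) (by simp [h])

end Scarf

section Covering

variable {I : Type*} [Fintype I] [Nonempty I]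

theorem exists_le_sum_eq {a : I → ℕ} {m : ℕ} (ha : ∑ i, a i ≤ m) : ∃ y, a ≤ y ∧ ∑ i, y i = m := by
  classical
  obtain ⟨i⟩ := ‹Nonempty I›
  refine ⟨a + Pi.single i (m - ∑ i, a i), le_self_add, ?_⟩
  simp only [Pi.add_apply, Finset.sum_add_distrib, Finset.sum_pi_single', Finset.mem_univ, if_true]
  exact Nat.add_sub_cancel' ha

theorem exists_grid_point (m : ℕ) (c : (I → ℕ) → I) :
    ∃ μ : I → ℕ, ∑ i, μ i ≤ m ∧ m ≤ ∑ i, μ i + Fintype.card I ∧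
      ∀ i, μ i = 0 ∨ ∃ y, ∑ j, y j = m ∧ μ ≤ y ∧ c y = i := by
  classical
  let G : Finset (I → ℕ) := Finset.piAntidiag Finset.univ m
  have hG : ∀ y, y ∈ G ↔ ∑ i, y i = m := fun y => by
    simp only [G, Finset.mem_piAntidiag, Finset.mem_univ, implies_true, and_true]
  obtain ⟨σ, hσ⟩ := exists_forall_exists_mem_forall_le (fun i (y : G) => y.1 i) fun y => c y.1
  obtain ⟨x, hx⟩ : σ.Nonempty := by
    obtain ⟨y, -, hy⟩ := exists_le_sum_eq (I := I) (a := 0) (m := m) (by simp)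
    exact (hσ ⟨y, (hG y).2 hy⟩).imp fun _ h => h.1
  let μ : I → ℕ := fun i => if ∃ y ∈ σ, c y.1 = i then σ.inf' ⟨x, hx⟩ fun y => y.1 i else 0
  have hμ : ∀ y ∈ σ, μ ≤ y.1 := fun y hy i => by
    dsimp only [μ]
    split_ifs
    · exact Finset.inf'_le (fun y : G => y.1 i) hy
    · exact Nat.zero_le _
  refine ⟨μ, ((Finset.sum_le_sum fun i _ => hμ x hx i).trans_eq ((hG _).1 x.2)), ?_, fun i => ?_⟩
  · by_contra! hlt
    obtain ⟨y, hμy, hy⟩ := exists_le_sum_eq (I := I) (a := μ + 1) (m := m) (by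
      simpa [Finset.sum_add_distrib] using hlt.le)
    obtain ⟨x₀, hx₀, h⟩ := hσ ⟨y, (hG y).2 hy⟩
    have hle : y (c x₀.1) ≤ μ (c x₀.1) := by
      dsimp only [μ]
      rw [if_pos ⟨x₀, hx₀, rfl⟩]
      exact Finset.le_inf' _ _ h
    exact absurd ((hμy (c x₀.1)).trans hle) (Nat.not_succ_le_self _)
  · by_cases hi : ∃ y ∈ σ, c y.1 = i
    · obtain ⟨y, hy, hyi⟩ := hi
      exact Or.inr ⟨y.1, (hG _).1 y.2, hμ y hy, hyi⟩
    · exact Or.inl (if_neg hi)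

theorem exists_approx_mem_of_stdSimplex_subset_iUnion {A : I → Set (I → ℝ)}
    (hA : stdSimplex ℝ I ⊆ ⋃ i, A i) {ε : ℝ} (hε : 0 < ε) :
    ∃ x : I → ℝ, 0 ≤ x ∧ ∑ i, x i ∈ Set.Icc (1 - ε) 1 ∧
      ∀ i, x i = 0 ∨ ∃ y ∈ A i, dist y x ≤ ε := by
  obtain ⟨m, hm⟩ := exists_nat_gt (Fintype.card I / ε)
  have hm0 : (0 : ℝ) < m := lt_of_le_of_lt (by positivity) hm
  have hcard : (Fintype.card I : ℝ) / m ≤ ε := (div_le_comm₀ hm0 hε).2 hm.le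
  have hcolour : ∀ y : I → ℕ, ∃ i, ∑ j, y j = m → (fun j => (y j : ℝ) / m) ∈ A i := fun y => by
    by_cases hy : ∑ j, y j = m
    · have hmem : (fun j => (y j : ℝ) / m) ∈ stdSimplex ℝ I :=
        ⟨fun j => by positivity, by
          rw [← Finset.sum_div, ← Nat.cast_sum, hy, div_self hm0.ne']⟩
      exact (Set.mem_iUnion.1 (hA hmem)).imp fun i hi _ => hi
    · exact ⟨Classical.arbitrary I, fun h => absurd h hy⟩
  choose c hc using hcolour
  obtain ⟨μ, hle, hge, hμ⟩ := exists_grid_point m c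
  refine ⟨fun i => μ i / m, fun i => by positivity, ?_, fun i => (hμ i).imp (fun h => ?_) ?_⟩
  · rw [← Finset.sum_div, ← Nat.cast_sum]
    refine ⟨?_, (div_le_one hm0).2 (mod_cast hle)⟩
    rw [sub_le_iff_le_add]
    calc (1 : ℝ) = m / m := (div_self hm0.ne').symm
      _ ≤ ((∑ i, μ i : ℕ) + Fintype.card I) / m := by gcongr; exact_mod_cast hge
      _ = (∑ i, μ i : ℕ) / m + Fintype.card I / m := add_div _ _ _
      _ ≤ (∑ i, μ i : ℕ) / m + ε := by gcongr
  · simp only [h, Nat.cast_zero, zero_div]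
  · rintro ⟨y, hy, hμy, rfl⟩
    refine ⟨_, hc y hy, (dist_pi_le_iff hε.le).2 fun j => ?_⟩
    have hdiff : y j - μ j ≤ Fintype.card I := by
      have hsub : ∑ j, (y j - μ j) = m - ∑ j, μ j := by
        rw [Finset.sum_tsub_distrib _ fun j _ => hμy j, hy]
      have := Finset.single_le_sum (f := fun j => y j - μ j) (fun _ _ => Nat.zero_le _)
        (Finset.mem_univ j)
      lia
    rw [Real.dist_eq, ← sub_div, ← Nat.cast_sub (hμy j), abs_of_nonneg (by positivity)]
    exact le_trans (by gcongr) hcard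

/-- A covering lemma of Knaster–Kuratowski–Mazurkiewicz type for the standard simplex. -/
theorem stdSimplex_inter_iInter_nonempty {A : I → Set (I → ℝ)} (hclosed : ∀ i, IsClosed (A i))
    (hA : stdSimplex ℝ I ⊆ ⋃ i, A i) (hface : ∀ x ∈ stdSimplex ℝ I, ∀ i, x i = 0 → x ∈ A i) :
    (stdSimplex ℝ I ∩ ⋂ i, A i).Nonempty := by
  choose x hx0 hx1 hx using fun n : ℕ => exists_approx_mem_of_stdSimplex_subset_iUnion hA
    (Nat.one_div_pos_of_nat (α := ℝ) (n := n))
  have hmem : ∀ n, x n ∈ Set.Icc (0 : I → ℝ) 1 := fun n => ⟨hx0 n, fun i =>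
    (Finset.single_le_sum (fun j _ => hx0 n j) (Finset.mem_univ i)).trans (hx1 n).2⟩
  obtain ⟨z, hz, φ, hφ, hlim⟩ := isCompact_Icc.tendsto_subseq hmem
  have hε := (tendsto_one_div_add_atTop_nhds_zero_nat (𝕜 := ℝ)).comp hφ.tendsto_atTop
  have hsum : ∑ i, z i = 1 := by
    have hcont : Continuous fun y : I → ℝ => ∑ i, y i := by fun_prop
    refine tendsto_nhds_unique ((hcont.tendsto z).comp hlim) ?_
    refine tendsto_of_tendsto_of_tendsto_of_le_of_le (by simpa using hε.const_sub 1)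
      tendsto_const_nhds (fun n => (hx1 (φ n)).1) fun n => (hx1 (φ n)).2
  have hzS : z ∈ stdSimplex ℝ I := ⟨hz.1, hsum⟩
  refine ⟨z, hzS, Set.mem_iInter.2 fun i => ?_⟩
  by_cases hzi : z i = 0
  · exact hface z hzS i hzi
  refine (hclosed i).closure_subset (Metric.mem_closure_iff.2 fun ε hpos => ?_)
  have hne : ∀ᶠ n in Filter.atTop, x (φ n) i ≠ 0 :=
    (tendsto_pi_nhds.1 hlim i).eventually_ne hzi
  have hnear := Metric.tendsto_nhds.1 hlim (ε / 2) (half_pos hpos)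
  obtain ⟨n, hn, hn1, hn2⟩ :=
    (hne.and (hnear.and (hε.eventually_lt_const (half_pos hpos)))).exists
  obtain ⟨y, hy, hdist⟩ := (hx (φ n) i).resolve_left hn
  refine ⟨y, hy, ?_⟩
  simp only [Function.comp_apply] at hn1 hn2
  calc dist z y ≤ dist (x (φ n)) z + dist y (x (φ n)) := by
        rw [dist_comm z y, add_comm]; exact dist_triangle _ _ _
    _ < ε / 2 + ε / 2 := by linarith
    _ = ε := add_halves ε

/-- The Gale–Nikaido–Debreu lemma. -/
theorem exists_excess_demand_nonpos {z : (I → ℝ) → I → ℝ} (hz : ContinuousOn z (stdSimplex ℝ I))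
    (hW : ∀ p ∈ stdSimplex ℝ I, p ⬝ᵥ z p ≤ 0) : ∃ p ∈ stdSimplex ℝ I, z p ≤ 0 := by
  let S : (I → ℝ) → ℝ := fun p => ∑ j, max (z p j) 0
  have hS : ∀ p, 0 ≤ S p := fun p => Finset.sum_nonneg fun i _ => le_max_right _ _
  have hmax : ∀ i, ContinuousOn (fun p => max (z p i) 0) (stdSimplex ℝ I) := fun i =>
    ((continuous_apply i).comp_continuousOn hz).sup continuousOn_const
  have hSc : ContinuousOn S (stdSimplex ℝ I) := continuousOn_finsetSum _ fun i _ => hmax i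
  have hclosed : ∀ i, IsClosed {p ∈ stdSimplex ℝ I | p i * S p ≤ max (z p i) 0} := fun i =>
    (isClosed_stdSimplex ℝ I).isClosed_le ((continuous_apply i).continuousOn.mul hSc) (hmax i)
  have hsum : ∀ p ∈ stdSimplex ℝ I, ∑ i, p i * S p = S p := fun p hp => by
    rw [← Finset.sum_mul, hp.2, one_mul]
  obtain ⟨p, hp, hpA⟩ := stdSimplex_inter_iInter_nonempty hclosed
    (fun p hp => by
      obtain ⟨i, -, hi⟩ := Finset.exists_le_of_sum_le Finset.univ_nonempty (hsum p hp).le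
      exact Set.mem_iUnion.2 ⟨i, hp, hi⟩)
    fun p hp i hpi => ⟨hp, by rw [hpi, zero_mul]; exact le_max_right _ _⟩
  have heq : ∀ i, p i * S p = max (z p i) 0 := fun i =>
    (Finset.sum_eq_sum_iff_of_le fun i _ => (Set.mem_iInter.1 hpA i).2).1 (hsum p hp) i
      (Finset.mem_univ i)
  have hnonneg : ∀ i ∈ Finset.univ, 0 ≤ max (z p i) 0 * z p i := fun i _ => by
    rcases le_total (z p i) 0 with h | h
    · rw [max_eq_right h, zero_mul]
    · exact mul_nonneg (le_max_right _ _) h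
  have hnonpos : ∑ i, max (z p i) 0 * z p i ≤ 0 := by
    calc ∑ i, max (z p i) 0 * z p i = S p * (p ⬝ᵥ z p) := by
          rw [dotProduct, Finset.mul_sum]
          refine Finset.sum_congr rfl fun i _ => ?_
          rw [← heq i]
          ring
      _ ≤ 0 := mul_nonpos_of_nonneg_of_nonpos (hS p) (hW p hp)
  refine ⟨p, hp, fun i => le_of_not_gt fun h : 0 < z p i => ?_⟩
  have hzero := (Finset.sum_eq_zero_iff_of_nonneg hnonneg).1
    (hnonpos.antisymm (Finset.sum_nonneg hnonneg)) i (Finset.mem_univ i)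
  rw [max_eq_left h.le] at hzero
  exact (mul_pos h h).ne' hzero

end Covering

section Utility

variable {K : ℕ} {u : (Fin K → ℝ) → EReal} {B : Set (Fin K → ℝ)} {d x y : Fin K → ℝ}

/-- The nonnegative bundles of finite utility, on which `u` is a real-valued function. -/
def effectiveDomain (u : (Fin K → ℝ) → EReal) : Set (Fin K → ℝ) :=
  {x | 0 ≤ x ∧ ⊥ < u x}

theorem IsUtility.mem_effectiveDomain (hu : IsUtility u) (hx : ∀ k, 0 < x k) :
    x ∈ effectiveDomain u :=
  ⟨fun k => (hx k).le, hu.finite_of_pos x hx⟩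

theorem IsUtility.coe_toReal (hu : IsUtility u) (hx : x ∈ effectiveDomain u) :
    ((u x).toReal : EReal) = u x :=
  EReal.coe_toReal (hu.lt_top x hx.1).ne hx.2.ne'

theorem IsUtility.toReal_le_toReal_iff (hu : IsUtility u) (hx : x ∈ effectiveDomain u)
    (hy : y ∈ effectiveDomain u) : (u x).toReal ≤ (u y).toReal ↔ u x ≤ u y := by
  rw [← EReal.coe_le_coe_iff, hu.coe_toReal hx, hu.coe_toReal hy]

theorem IsUtility.add_mem_effectiveDomain (hu : IsUtility u) (hx : x ∈ effectiveDomain u)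
    (hy : 0 < y) : x + y ∈ effectiveDomain u :=
  ⟨add_nonneg hx.1 hy.le,
    hx.2.trans (hu.strictlyIncreasing x _ hx.1 hx.2 (lt_add_of_pos_right x hy))⟩

theorem IsUtility.lt_add (hu : IsUtility u) (hx : x ∈ effectiveDomain u) (hy : 0 < y) :
    u x < u (x + y) :=
  hu.strictlyIncreasing x _ hx.1 hx.2 (lt_add_of_pos_right x hy)

theorem IsUtility.strictConcaveOn_toReal (hu : IsUtility u) :
    StrictConcaveOn ℝ (effectiveDomain u) fun x => (u x).toReal := by
  have hmem : ∀ {x y}, x ∈ effectiveDomain u → y ∈ effectiveDomain u → x ≠ y → ∀ {a b : ℝ},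
      0 < a → 0 < b → a + b = 1 → a • x + b • y ∈ effectiveDomain u :=
    fun {x y} hx hy hxy {a b} ha hb hab =>
      ⟨add_nonneg (smul_nonneg ha.le hx.1) (smul_nonneg hb.le hy.1), bot_le.trans_lt
        (hu.strictlyConcave x y hx.1 hy.1 hx.2 hy.2 hxy a b ha hb hab)⟩
  refine ⟨convex_iff_pairwise_pos.2 fun x hx y hy hxy a b ha hb hab =>
    hmem hx hy hxy ha hb hab, fun x hx y hy hxy a b ha hb hab => ?_⟩
  have h := hu.strictlyConcave x y hx.1 hy.1 hx.2 hy.2 hxy a b ha hb hab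
  rw [← hu.coe_toReal hx, ← hu.coe_toReal hy, ← hu.coe_toReal (hmem hx hy hxy ha hb hab)] at h
  exact_mod_cast h

theorem IsUtility.isMaxOn_toReal_iff (hu : IsUtility u) (hB : ∀ y ∈ B, 0 ≤ y)
    (hd : d ∈ effectiveDomain u) :
    IsMaxOn (fun y => (u y).toReal) (B ∩ effectiveDomain u) d ↔ IsMaxOn u B d := by
  refine ⟨fun h y hy => ?_, fun h y hy => (hu.toReal_le_toReal_iff hy.2 hd).2 (h hy.1)⟩
  by_cases hbot : ⊥ < u y
  · exact (hu.toReal_le_toReal_iff ⟨hB y hy, hbot⟩ hd).1 (h ⟨hy, hB y hy, hbot⟩)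
  · exact (not_lt.1 hbot).trans bot_le

end Utility

section Demand

variable {K : ℕ} {u : (Fin K → ℝ) → EReal} {B s : Set (Fin K → ℝ)} {c d d' e p : Fin K → ℝ}
  {m : ℝ}

/-- The bundle `d` is a utility maximizer among the bundles in `B`. -/
structure IsDemand (u : (Fin K → ℝ) → EReal) (B : Set (Fin K → ℝ)) (d : Fin K → ℝ) : Prop where
  mem : d ∈ B
  isMaxOn : IsMaxOn u B d

/-- The bundles affordable with income `m` at prices `p`. -/
def budgetSet (p : Fin K → ℝ) (m : ℝ) : Set (Fin K → ℝ) :=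
  {y | 0 ≤ y ∧ p ⬝ᵥ y ≤ m}

theorem convex_budgetSet (p : Fin K → ℝ) (m : ℝ) : Convex ℝ (budgetSet p m) :=
  (convex_Ici 0).inter (convex_halfSpace_le (dotProductBilin ℝ ℝ p).isLinear m)

theorem isCompact_budgetSet_inter_Iic (p : Fin K → ℝ) (m : ℝ) (c : Fin K → ℝ) :
    IsCompact (budgetSet p m ∩ Set.Iic c) := by
  have hclosed : IsClosed {y : Fin K → ℝ | p ⬝ᵥ y ≤ m} :=
    isClosed_le (continuous_const.dotProduct continuous_id) continuous_const
  refine ((isCompact_Icc (a := (0 : Fin K → ℝ)) (b := c)).inter_right hclosed).of_isClosed_subset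
    ((isClosed_Ici.inter hclosed).inter isClosed_Iic) fun y hy => ⟨⟨hy.1.1, hy.2⟩, hy.1.2⟩

theorem IsUtility.exists_isDemand (hu : IsUtility u) (hB : IsCompact B) (hne : B.Nonempty)
    (hB0 : ∀ y ∈ B, 0 ≤ y) : ∃ d, IsDemand u B d :=
  let ⟨d, hd, hmax⟩ := hB.exists_isMaxOn hne (hu.continuousOn.mono hB0)
  ⟨d, hd, hmax⟩

theorem IsDemand.mem_effectiveDomain (hd : IsDemand u B d) (hB : ∀ y ∈ B, 0 ≤ y) (he : e ∈ B)
    (hue : ⊥ < u e) : d ∈ effectiveDomain u :=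
  ⟨hB d hd.mem, hue.trans_le (hd.isMaxOn he)⟩

theorem IsDemand.unique (hu : IsUtility u) (hBc : Convex ℝ B) (hB : ∀ y ∈ B, 0 ≤ y)
    (hdom : d ∈ effectiveDomain u) (hd : IsDemand u B d) (hd' : IsDemand u B d') : d = d' := by
  have hdom' : d' ∈ effectiveDomain u := ⟨hB d' hd'.mem, hdom.2.trans_le (hd'.isMaxOn hd.mem)⟩
  have hconc := hu.strictConcaveOn_toReal.subset (Set.inter_subset_right (s := B))
    (hBc.inter hu.strictConcaveOn_toReal.1)
  exact hconc.eq_of_isMaxOn ((hu.isMaxOn_toReal_iff hB hdom).2 hd.isMaxOn)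
    ((hu.isMaxOn_toReal_iff hB hdom').2 hd'.isMaxOn) ⟨hd.mem, hdom⟩ ⟨hd'.mem, hdom'⟩

theorem IsDemand.of_inter_of_mem_nhds (hu : IsUtility u) (hBc : Convex ℝ B) (hB : ∀ y ∈ B, 0 ≤ y)
    (hdom : d ∈ effectiveDomain u) (hd : IsDemand u (B ∩ s) d) (hs : s ∈ nhds d) :
    IsDemand u B d := by
  have hmem : d ∈ B ∩ effectiveDomain u := ⟨hd.mem.1, hdom⟩
  have hloc : IsLocalMaxOn (fun y => (u y).toReal) (B ∩ effectiveDomain u) d := by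
    filter_upwards [self_mem_nhdsWithin, mem_nhdsWithin_of_mem_nhds hs] with y hy hys
    exact (hu.toReal_le_toReal_iff hy.2 hdom).2 (hd.isMaxOn ⟨hy.1, hys⟩)
  have hconc := hu.strictConcaveOn_toReal.concaveOn.subset (Set.inter_subset_right (s := B))
    (hBc.inter hu.strictConcaveOn_toReal.1)
  exact ⟨hd.mem.1, (hu.isMaxOn_toReal_iff hB hdom).1 <|
    IsMaxOn.of_isLocalMaxOn_of_concaveOn hmem hloc hconc⟩

theorem IsUtility.isDemand_of_forall_lt (hu : IsUtility u) (hm : 0 < m)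
    (hd : d ∈ budgetSet p m ∩ Set.Iic c)
    (hmax : ∀ y, 0 ≤ y → y ≤ c → p ⬝ᵥ y < m → u y ≤ u d) :
    IsDemand u (budgetSet p m ∩ Set.Iic c) d := by
  refine ⟨hd, fun y ⟨⟨hy0, hpy⟩, hyc⟩ => ?_⟩
  have hscale : Filter.Tendsto (fun t : ℝ => t • y) (nhdsWithin 1 (Set.Ioo 0 1))
      (nhdsWithin y {x | 0 ≤ x}) := by
    refine tendsto_nhdsWithin_iff.2 ⟨?_, ?_⟩
    · have hcont : Continuous fun t : ℝ => t • y := by fun_prop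
      exact (hcont.tendsto' 1 y (one_smul ℝ y)).mono_left nhdsWithin_le_nhds
    · filter_upwards [self_mem_nhdsWithin] with t ht
      exact smul_nonneg ht.1.le hy0
  have : (nhdsWithin (1 : ℝ) (Set.Ioo 0 1)).NeBot := by
    rw [← mem_closure_iff_nhdsWithin_neBot, closure_Ioo zero_ne_one]
    exact Set.right_mem_Icc.2 zero_le_one
  refine le_of_tendsto ((hu.continuousOn y hy0).tendsto.comp hscale) ?_
  filter_upwards [self_mem_nhdsWithin] with t ht
  refine hmax (t • y) (smul_nonneg ht.1.le hy0) ?_ ?_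
  · exact (smul_le_of_le_one_left hy0 ht.2.le).trans hyc
  · calc p ⬝ᵥ (t • y) = t * p ⬝ᵥ y := by rw [dotProduct_smul, smul_eq_mul]
      _ ≤ t * m := mul_le_mul_of_nonneg_left hpy ht.1.le
      _ < m := mul_lt_of_lt_one_left hm ht.2

theorem IsUtility.continuousAt_demand (hu : IsUtility u) (he : ∀ k, 0 < e k) (hec : e ≤ c)
    {D : (Fin K → ℝ) → Fin K → ℝ}
    (hD : ∀ q, IsDemand u (budgetSet q (q ⬝ᵥ e) ∩ Set.Iic c) (D q)) (hp : 0 < p ⬝ᵥ e) :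
    ContinuousAt D p := by
  have hB : ∀ y ∈ budgetSet p (p ⬝ᵥ e) ∩ Set.Iic c, 0 ≤ y := fun y hy => hy.1.1
  have heB : e ∈ budgetSet p (p ⬝ᵥ e) ∩ Set.Iic c := ⟨⟨fun k => (he k).le, le_rfl⟩, hec⟩
  have hmem : ∀ q, D q ∈ Set.Icc 0 c := fun q => ⟨(hD q).mem.1.1, (hD q).mem.2⟩
  refine isCompact_Icc.tendsto_nhds_of_unique_mapClusterPt (.of_forall hmem) fun d hd hcl => ?_
  obtain ⟨U, hU, hlim⟩ := mapClusterPt_iff_ultrafilter.1 hcl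
  have hdot : ∀ {g : (Fin K → ℝ) → Fin K → ℝ} {y}, Filter.Tendsto g U (nhds y) →
      Filter.Tendsto (fun q => q ⬝ᵥ g q) U (nhds (p ⬝ᵥ y)) := fun {g y} hg =>
    ((continuous_fst.dotProduct continuous_snd).tendsto (p, y)).comp
      ((Filter.tendsto_id'.2 hU).prodMk_nhds hg)
  have hafford : p ⬝ᵥ d ≤ p ⬝ᵥ e := le_of_tendsto_of_tendsto' (hdot hlim)
    (hdot tendsto_const_nhds) fun q => (hD q).mem.1.2
  have hulim : Filter.Tendsto (fun q => u (D q)) U (nhds (u d)) :=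
    (hu.continuousOn d hd.1).tendsto.comp
      (tendsto_nhdsWithin_iff.2 ⟨hlim, .of_forall fun q => (hmem q).1⟩)
  have hdemand := hu.isDemand_of_forall_lt hp ⟨⟨hd.1, hafford⟩, hd.2⟩ fun y hy0 hyc hpy => by
    refine ge_of_tendsto hulim ?_
    filter_upwards [(hdot tendsto_const_nhds).eventually_lt (hdot tendsto_const_nhds) hpy] with q hq
    exact (hD q).isMaxOn ⟨⟨hy0, hq.le⟩, hyc⟩
  exact hdemand.unique hu ((convex_budgetSet _ _).inter (convex_Iic c)) hB
    (hdemand.mem_effectiveDomain hB heB (hu.finite_of_pos e he)) (hD p)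

theorem IsDemand.lt_dotProduct_add (hu : IsUtility u) (hd : IsDemand u (budgetSet p m) d)
    (hdom : d ∈ effectiveDomain u) {v : Fin K → ℝ} (hv : 0 < v) : m < p ⬝ᵥ d + p ⬝ᵥ v := by
  by_contra! hle
  rw [← dotProduct_add] at hle
  exact (hu.lt_add hdom hv).not_ge (hd.isMaxOn ⟨add_nonneg hdom.1 hv.le, hle⟩)

theorem IsDemand.price_pos (hu : IsUtility u) (hd : IsDemand u (budgetSet p m) d)
    (hdom : d ∈ effectiveDomain u) (k : Fin K) : 0 < p k := by
  have hlt := hd.lt_dotProduct_add hu hdom (v := Pi.single k 1) (Pi.single_pos.2 one_pos)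
  rw [dotProduct_single_one] at hlt
  linarith [hd.mem.2]

theorem IsDemand.dotProduct_eq [NeZero K] (hu : IsUtility u) (hd : IsDemand u (budgetSet p m) d)
    (hdom : d ∈ effectiveDomain u) : p ⬝ᵥ d = m := by
  have hp := hd.price_pos hu hdom 0
  refine hd.mem.2.antisymm (not_lt.1 fun hlt => ?_)
  have hgap := hd.lt_dotProduct_add hu hdom (v := Pi.single 0 ((m - p ⬝ᵥ d) / p 0))
    (Pi.single_pos.2 (div_pos (sub_pos.2 hlt) hp))
  rw [dotProduct_single, mul_div_cancel₀ _ hp.ne', add_sub_cancel] at hgap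
  exact hgap.false

end Demand

section Equilibrium

variable {N K : ℕ} {u : Fin N → (Fin K → ℝ) → EReal} {ω x d : Fin N → Fin K → ℝ}
  {a b e p : Fin K → ℝ}

theorem dotProduct_totalEndowment (p : Fin K → ℝ) (ω : Fin N → Fin K → ℝ) :
    p ⬝ᵥ totalEndowment ω = ∑ i, p ⬝ᵥ ω i :=
  dotProduct_sum p _ ω

theorem totalEndowment_pos [NeZero N] (hω : ∀ i k, 0 < ω i k) (k : Fin K) :
    0 < totalEndowment ω k := by
  rw [totalEndowment, Finset.sum_apply]
  exact Finset.sum_pos (fun i _ => hω i k) Finset.univ_nonempty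

theorem dotProduct_pos_of_mem_stdSimplex (hp : p ∈ stdSimplex ℝ (Fin K)) (he : ∀ k, 0 < e k) :
    0 < p ⬝ᵥ e := by
  obtain ⟨k, hk⟩ : ∃ k, 0 < p k := by
    by_contra! hle
    exact zero_lt_one.not_ge (hp.2.symm.trans_le (Finset.sum_nonpos fun k _ => hle k))
  exact Finset.sum_pos' (fun k _ => mul_nonneg (hp.1 k) (he k).le)
    ⟨k, Finset.mem_univ k, mul_pos hk (he k)⟩

theorem eq_of_le_of_dotProduct_eq (hp : ∀ k, 0 < p k) (hab : a ≤ b) (h : p ⬝ᵥ a = p ⬝ᵥ b) :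
    a = b :=
  funext fun k => mul_left_cancel₀ (hp k).ne' <| (Finset.sum_eq_sum_iff_of_le fun k _ =>
    mul_le_mul_of_nonneg_left (hab k) (hp k).le).1 h k (Finset.mem_univ k)

theorem IsWalrasianEquilibrium.isDemand (h : IsWalrasianEquilibrium u ω x p) (i : Fin N) :
    IsDemand (u i) (budgetSet p (p ⬝ᵥ ω i)) (x i) :=
  ⟨⟨h.bundle_nonneg i, h.budget i⟩, fun y hy => h.optimal i y hy.1 hy.2⟩

theorem IsWalrasianEquilibrium.smul (h : IsWalrasianEquilibrium u ω x p) {t : ℝ} (ht : 0 < t) :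
    IsWalrasianEquilibrium u ω x (t • p) := by
  have hscale : ∀ y z, (t • p) ⬝ᵥ y ≤ (t • p) ⬝ᵥ z ↔ p ⬝ᵥ y ≤ p ⬝ᵥ z := fun y z => by
    rw [smul_dotProduct, smul_dotProduct, smul_le_smul_iff_of_pos_left ht]
  exact ⟨smul_nonneg ht.le h.price_nonneg, h.bundle_nonneg, fun i => (hscale _ _).2 (h.budget i),
    fun i y hy hpy => h.optimal i y hy ((hscale _ _).1 hpy), h.market_clearing⟩

theorem exists_isDemand_sum_le_totalEndowment [NeZero K] (hu : ∀ i, IsUtility (u i))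
    (hω : ∀ i k, 0 < ω i k) :
    ∃ (p : Fin K → ℝ) (d : Fin N → Fin K → ℝ),
      (∀ i, IsDemand (u i) (budgetSet p (p ⬝ᵥ ω i)) (d i)) ∧ ∑ i, d i ≤ totalEndowment ω := by
  set w := totalEndowment ω
  have hωw : ∀ i, ω i ≤ w + 1 := fun i => (Finset.single_le_sum (f := ω)
    (fun j _ k => (hω j k).le) (Finset.mem_univ i)).trans (le_add_of_nonneg_right zero_le_one)
  have hωB : ∀ i q, ω i ∈ budgetSet q (q ⬝ᵥ ω i) ∩ Set.Iic (w + 1) := fun i q =>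
    ⟨⟨fun k => (hω i k).le, le_rfl⟩, hωw i⟩
  choose D hD using fun i q => (hu i).exists_isDemand (isCompact_budgetSet_inter_Iic q _ (w + 1))
    ⟨ω i, hωB i q⟩ fun y hy => hy.1.1
  obtain ⟨p, -, hz⟩ := exists_excess_demand_nonpos (z := fun q => ∑ i, D i q - w)
    ((continuousOn_finsetSum _ fun i _ q hq => ((hu i).continuousAt_demand (hω i) (hωw i) (hD i)
      (dotProduct_pos_of_mem_stdSimplex hq (hω i))).continuousWithinAt).sub continuousOn_const)
    (fun q _ => by
      rw [dotProduct_sub, dotProduct_sum, dotProduct_totalEndowment, sub_nonpos]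
      exact Finset.sum_le_sum fun i _ => (hD i q).mem.1.2)
  have hle : ∀ i k, D i p k < (w + 1) k := fun i k => lt_of_le_of_lt
    ((Finset.single_le_sum (f := fun j => D j p) (fun j _ => (hD j p).mem.1.1)
      (Finset.mem_univ i)).trans (sub_nonpos.1 hz) k) (lt_add_one (w k))
  exact ⟨p, fun i => D i p, fun i => (hD i p).of_inter_of_mem_nhds (hu i) (convex_budgetSet _ _)
    (fun y hy => hy.1) ((hD i p).mem_effectiveDomain (fun y hy => hy.1.1) (hωB i p)
      ((hu i).finite_of_pos _ (hω i))) (pi_Iic_mem_nhds (hle i)), sub_nonpos.1 hz⟩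

theorem isWalrasianEquilibrium_of_sum_le [NeZero N] [NeZero K] (hu : ∀ i, IsUtility (u i))
    (hω : ∀ i k, 0 < ω i k) (hd : ∀ i, IsDemand (u i) (budgetSet p (p ⬝ᵥ ω i)) (d i))
    (hsum : ∑ i, d i ≤ totalEndowment ω) : IsWalrasianEquilibrium u ω d p := by
  have hdom : ∀ i, d i ∈ effectiveDomain (u i) := fun i => (hd i).mem_effectiveDomain
    (fun y hy => hy.1) ⟨fun k => (hω i k).le, le_rfl⟩ ((hu i).finite_of_pos _ (hω i))
  have hp := (hd 0).price_pos (hu 0) (hdom 0)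
  refine ⟨fun k => (hp k).le, fun i => (hd i).mem.1, fun i => (hd i).mem.2,
    fun i y hy hpy => (hd i).isMaxOn ⟨hy, hpy⟩, eq_of_le_of_dotProduct_eq hp hsum ?_⟩
  rw [dotProduct_sum, dotProduct_totalEndowment]
  exact Finset.sum_congr rfl fun i _ => (hd i).dotProduct_eq (hu i) (hdom i)

theorem exists_isWalrasianEquilibrium [NeZero N] (hu : ∀ i, IsUtility (u i))
    (hω : ∀ i k, 0 < ω i k) : ∃ x p, IsWalrasianEquilibrium u ω x p := by
  rcases K.eq_zero_or_pos with rfl | hK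
  · exact ⟨ω, 0, le_rfl, fun i k => (hω i k).le, fun i => le_rfl,
      fun i y _ _ => (congrArg (u i) (Subsingleton.elim y (ω i))).le, rfl⟩
  · have : NeZero K := ⟨hK.ne'⟩
    obtain ⟨p, x, hx, hsum⟩ := exists_isDemand_sum_le_totalEndowment hu hω
    exact ⟨x, p, isWalrasianEquilibrium_of_sum_le hu hω hx hsum⟩

end Equilibrium

section Multiplier

variable {E : Type*} [AddCommGroup E] [Module ℝ E] {C : Set E} {f : E → ℝ} {φ : E →ₗ[ℝ] ℝ}
  {x y z : E}

theorem div_le_div_of_concaveOn (hf : ConcaveOn ℝ C f)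
    (hmax : ∀ v ∈ C, φ v ≤ φ x → f v ≤ f x) (hy : y ∈ C) (hz : z ∈ C) (hyx : φ y < φ x)
    (hxz : φ x < φ z) : (f z - f x) / (φ z - φ x) ≤ (f x - f y) / (φ x - φ y) := by
  have ha : 0 < φ z - φ x := sub_pos.2 hxz
  have hb : 0 < φ x - φ y := sub_pos.2 hyx
  set a := φ z - φ x with ha_def
  set b := φ x - φ y with hb_def
  have hab : a / (a + b) + b / (a + b) = 1 := by rw [← add_div, div_self (add_pos ha hb).ne']
  have ha' : 0 ≤ a / (a + b) := by positivity
  have hb' : 0 ≤ b / (a + b) := by positivity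
  have hφ : φ ((a / (a + b)) • y + (b / (a + b)) • z) = φ x := by
    rw [map_add, map_smul, map_smul, smul_eq_mul, smul_eq_mul]
    field_simp
    rw [ha_def, hb_def]
    ring
  have hle := (hf.2 hy hz ha' hb' hab).trans (hmax _ (hf.1 hy hz ha' hb' hab) hφ.le)
  rw [smul_eq_mul, smul_eq_mul, div_mul_eq_mul_div, div_mul_eq_mul_div, ← add_div,
    div_le_iff₀ (add_pos ha hb)] at hle
  rw [div_le_div_iff₀ ha hb]
  linarith

/- The multiplier separates the slopes of the gains above the level `φ x` from those of the losses
below it; a point strictly below that level keeps it finite. -/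
theorem exists_isMaxOn_sub_mul_of_concaveOn (hf : ConcaveOn ℝ C f)
    (hmax : ∀ v ∈ C, φ v ≤ φ x → f v ≤ f x) (hy : y ∈ C) (hyx : φ y < φ x) :
    ∃ l, 0 ≤ l ∧ IsMaxOn (fun v => f v - l * φ v) C x := by
  obtain ⟨l, hgain, hloss⟩ := exists_between_of_forall_le
    (s := insert 0 ((fun z => (f z - f x) / (φ z - φ x)) '' {z ∈ C | φ x < φ z}))
    (t := (fun y => (f x - f y) / (φ x - φ y)) '' {y ∈ C | φ y < φ x})
    (Set.insert_nonempty _ _) ⟨_, y, ⟨hy, hyx⟩, rfl⟩ (by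
      rintro _ (rfl | ⟨z, ⟨hz, hxz⟩, rfl⟩) _ ⟨y, ⟨hy, hyx⟩, rfl⟩
      · exact div_nonneg (sub_nonneg.2 (hmax y hy hyx.le)) (sub_nonneg.2 hyx.le)
      · exact div_le_div_of_concaveOn hf hmax hy hz hyx hxz)
  refine ⟨l, hgain (Set.mem_insert _ _), fun v hv => ?_⟩
  suffices hle : f v - f x ≤ l * (φ v - φ x) by
    change f v - l * φ v ≤ f x - l * φ x
    linarith
  rcases lt_trichotomy (φ v) (φ x) with hlt | heq | hgt
  · have hslope := (le_div_iff₀ (sub_pos.2 hlt)).1 (hloss ⟨v, ⟨hv, hlt⟩, rfl⟩)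
    linarith
  · rw [heq, sub_self, mul_zero]
    exact sub_nonpos.2 (hmax v hv heq.le)
  · exact (div_le_iff₀ (sub_pos.2 hgt)).1 (hgain (Set.mem_insert_of_mem _ ⟨v, ⟨hv, hgt⟩, rfl⟩))

end Multiplier

section Support

variable {K : ℕ} {u : (Fin K → ℝ) → EReal} {e p q x x' : Fin K → ℝ} {k : Fin K}

/-- At prices `q`, the bundle `x` maximizes utility minus cost among the bundles of finite
utility, that is, `q` is a supergradient of the utility function at `x`. -/
structure IsSupported (u : (Fin K → ℝ) → EReal) (q x : Fin K → ℝ) : Prop where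
  mem : x ∈ effectiveDomain u
  isMaxOn : IsMaxOn (fun y => (u y).toReal - q ⬝ᵥ y) (effectiveDomain u) x

theorem IsSupported.unique (hu : IsUtility u) (h : IsSupported u q x) (h' : IsSupported u q x') :
    x = x' := by
  have hconc := hu.strictConcaveOn_toReal.sub_convexOn
    ((dotProductBilin ℝ ℝ q).convexOn hu.strictConcaveOn_toReal.1)
  exact hconc.eq_of_isMaxOn h.isMaxOn h'.isMaxOn h.mem h'.mem

theorem IsSupported.price_pos (hu : IsUtility u) (h : IsSupported u q x) (k : Fin K) :
    0 < q k := by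
  have hsingle : 0 < (Pi.single k 1 : Fin K → ℝ) := Pi.single_pos.2 one_pos
  have hmem := hu.add_mem_effectiveDomain h.mem hsingle
  have hgain : (u x).toReal < (u (x + Pi.single k 1)).toReal := by
    rw [← not_le, hu.toReal_le_toReal_iff hmem h.mem, not_le]
    exact hu.lt_add h.mem hsingle
  have hmax : (u (x + Pi.single k 1)).toReal - q ⬝ᵥ (x + Pi.single k 1) ≤
    (u x).toReal - q ⬝ᵥ x := h.isMaxOn hmem
  rw [dotProduct_add, dotProduct_single_one] at hmax
  linarith

theorem dotProduct_update (q x : Fin K → ℝ) (k : Fin K) (t : ℝ) :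
    q ⬝ᵥ Function.update x k t = q ⬝ᵥ x + q k * (t - x k) := by
  have hupdate : Function.update x k t = x + Pi.single k (t - x k) := by
    rw [Pi.single, Function.update_eq_iff]
    exact ⟨by simp, fun j hj => by simp [hj]⟩
  rw [hupdate, dotProduct_add, dotProduct_single]

theorem IsUtility.eventually_update_mem_effectiveDomain (hu : IsUtility u)
    (hx : x ∈ effectiveDomain u) (hk : 0 < x k) :
    ∀ᶠ t in nhds (x k), Function.update x k t ∈ effectiveDomain u := by
  have hupdate : Filter.Tendsto (Function.update x k) (nhds (x k)) (nhds x) :=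
    (continuous_const.update k continuous_id).tendsto' _ _ (Function.update_eq_self k x)
  have hnonneg : ∀ᶠ t in nhds (x k), 0 ≤ Function.update x k t := by
    filter_upwards [lt_mem_nhds hk] with t ht
    exact le_update_iff.2 ⟨ht.le, fun j _ => hx.1 j⟩
  have hu_lim := (hu.continuousOn x hx.1).tendsto.comp
    (tendsto_nhdsWithin_iff.2 ⟨hupdate, hnonneg⟩)
  exact hnonneg.and (hu_lim.eventually_const_lt hx.2)

theorem IsSupported.price_eq_deriv (hu : IsUtility u) (h : IsSupported u q x) (hk : 0 < x k) :
    q k = deriv (fun t : ℝ => (u (Function.update x k t)).toReal) (x k) := by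
  have hmax : IsLocalMax (fun t : ℝ => (u (Function.update x k t)).toReal - q k * t) (x k) := by
    filter_upwards [hu.eventually_update_mem_effectiveDomain h.mem hk] with t ht
    have hle : (u (Function.update x k t)).toReal - q ⬝ᵥ Function.update x k t ≤
      (u x).toReal - q ⬝ᵥ x := h.isMaxOn ht
    rw [dotProduct_update] at hle
    rw [Function.update_eq_self]
    linarith
  have hderiv := hmax.deriv_eq_zero
  rw [deriv_fun_sub (hu.differentiable x h.mem.1 h.mem.2 k hk) (by fun_prop),
    deriv_const_mul_field, deriv_id'', mul_one] at hderiv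
  exact (sub_eq_zero.1 hderiv).symm

theorem IsDemand.exists_isSupported (hu : IsUtility u) (he : ∀ k, 0 < e k)
    (hx : IsDemand u (budgetSet p (p ⬝ᵥ e)) x) : ∃ l : ℝ, 0 < l ∧ IsSupported u (l • p) x := by
  have hdom : x ∈ effectiveDomain u := hx.mem_effectiveDomain (fun y hy => hy.1)
    ⟨fun k => (he k).le, le_rfl⟩ (hu.finite_of_pos e he)
  rcases K.eq_zero_or_pos with rfl | hK
  · exact ⟨1, one_pos, hdom, isMaxOn_iff.2 fun y _ => by rw [Subsingleton.elim y x]⟩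
  have : NeZero K := ⟨hK.ne'⟩
  have hp := hx.price_pos hu hdom
  have hpe : 0 < p ⬝ᵥ e :=
    Finset.sum_pos (fun k _ => mul_pos (hp k) (he k)) Finset.univ_nonempty
  have hbudget := hx.dotProduct_eq hu hdom
  obtain ⟨l, -, hmax⟩ := exists_isMaxOn_sub_mul_of_concaveOn (φ := dotProductBilin ℝ ℝ p)
    (y := (2⁻¹ : ℝ) • e) hu.strictConcaveOn_toReal.concaveOn
    (fun v hv hpv => (hu.toReal_le_toReal_iff hv hdom).2
      (hx.isMaxOn ⟨hv.1, hpv.trans_eq hbudget⟩))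
    (hu.mem_effectiveDomain fun k => mul_pos (by norm_num : (0 : ℝ) < 2⁻¹) (he k)) (by
      change p ⬝ᵥ (2⁻¹ : ℝ) • e < p ⬝ᵥ x
      rw [dotProduct_smul, smul_eq_mul, hbudget]
      linarith)
  have hs : IsSupported u (l • p) x := ⟨hdom, by
    simpa only [smul_dotProduct] using! hmax⟩
  exact ⟨l, pos_of_mul_pos_left (hs.price_pos hu 0) (hp 0).le, hs⟩

theorem le_fenchelDual_add_dotProduct (hx : 0 ≤ x) :
    u x ≤ fenchelDual u q + ((q ⬝ᵥ x : ℝ) : EReal) :=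
  (EReal.sub_le_iff_le_add (.inl (EReal.coe_ne_bot _)) (.inl (EReal.coe_ne_top _))).1 <|
    le_iSup₂ (f := fun y (_ : y ∈ {y : Fin K → ℝ | 0 ≤ y}) => u y - ((q ⬝ᵥ y : ℝ) : EReal)) x hx

theorem IsUtility.isSupported_iff_eq_fenchelDual_add (hu : IsUtility u)
    (hx : x ∈ effectiveDomain u) :
    IsSupported u q x ↔ u x = fenchelDual u q + ((q ⬝ᵥ x : ℝ) : EReal) := by
  have hle_iff : ∀ {y}, y ∈ effectiveDomain u →
      (u y - ((q ⬝ᵥ y : ℝ) : EReal) ≤ u x - ((q ⬝ᵥ x : ℝ) : EReal) ↔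
        (u y).toReal - q ⬝ᵥ y ≤ (u x).toReal - q ⬝ᵥ x) := fun {y} hy => by
    rw [← hu.coe_toReal hx, ← hu.coe_toReal hy, ← EReal.coe_sub, ← EReal.coe_sub,
      EReal.coe_le_coe_iff, EReal.toReal_coe, EReal.toReal_coe]
  rw [← (le_fenchelDual_add_dotProduct hx.1).ge_iff_eq, ← EReal.le_sub_iff_add_le
    (.inl (EReal.coe_ne_bot _)) (.inl (EReal.coe_ne_top _)), fenchelDual, iSup₂_le_iff]
  refine ⟨fun h y hy => ?_, fun h => ⟨hx, fun y hy => (hle_iff hy).1 (h y hy.1)⟩⟩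
  rcases eq_bot_or_bot_lt (u y) with hbot | hbot
  · rw [hbot, EReal.bot_sub]
    exact bot_le
  · exact (hle_iff ⟨hy, hbot⟩).2 (h.isMaxOn ⟨hy, hbot⟩)

end Support

section ExtendedReal

variable {ι : Type*} {s : Finset ι} {f g : ι → EReal} {i : ι} {a : ℝ} {v v' : EReal}

theorem coe_sum_ereal (s : Finset ι) (f : ι → ℝ) :
    ((∑ i ∈ s, f i : ℝ) : EReal) = ∑ i ∈ s, (f i : EReal) :=
  map_sum (⟨⟨Real.toEReal, EReal.coe_zero⟩, EReal.coe_add⟩ : ℝ →+ EReal) f s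

theorem ne_bot_of_sum_ne_bot (h : ∑ i ∈ s, f i ≠ ⊥) (hi : i ∈ s) : f i ≠ ⊥ := by
  classical
  rw [← Finset.add_sum_erase s f hi, EReal.add_ne_bot_iff] at h
  exact h.1

theorem eq_of_sum_eq_of_forall_le (hfg : ∀ i ∈ s, f i ≤ g i)
    (hsum : ∑ i ∈ s, f i = ∑ i ∈ s, g i) (hbot : ∑ i ∈ s, f i ≠ ⊥) (htop : ∑ i ∈ s, f i ≠ ⊤)
    (hi : i ∈ s) : f i = g i := by
  classical
  rw [← Finset.add_sum_erase s f hi, EReal.add_ne_bot_iff] at hbot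
  rw [← Finset.add_sum_erase s f hi] at htop
  have hrest : ∑ j ∈ s.erase i, f j ≤ ∑ j ∈ s.erase i, g j :=
    Finset.sum_le_sum fun j hj => hfg j (Finset.mem_of_mem_erase hj)
  refine (hfg i hi).eq_of_not_lt fun hlt => hsum.not_lt ?_
  rw [← Finset.add_sum_erase s f hi, ← Finset.add_sum_erase s g hi]
  refine EReal.add_lt_add_of_lt_of_le' hlt hrest (ne_bot_of_le_ne_bot hbot.2 hrest) fun _ h => ?_
  exact absurd (h ▸ EReal.add_top_of_ne_bot hbot.1) htop

theorem coe_mul_right_injective (ha : a ≠ 0) :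
    Function.Injective fun v : EReal => (a : EReal) * v :=
  Function.LeftInverse.injective (g := fun v : EReal => ((a⁻¹ : ℝ) : EReal) * v) fun v => by
    change ((a⁻¹ : ℝ) : EReal) * (a * v) = v
    rw [← mul_assoc, ← EReal.coe_mul, inv_mul_cancel₀ ha, EReal.coe_one, one_mul]

theorem ereal_sub_eq_zero_iff : v - v' = 0 ↔ v = v' ∧ v ≠ ⊥ ∧ v ≠ ⊤ := by
  refine ⟨fun h => ?_, fun ⟨h, hbot, htop⟩ => h ▸ EReal.sub_self htop hbot⟩
  induction v <;> induction v' <;> simp_all [← EReal.coe_sub, sub_eq_zero]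

end ExtendedReal

section FenchelYoung

variable {K : ℕ} {u : (Fin K → ℝ) → EReal} {x : Fin K → ℝ} {a : ℝ}

theorem coe_mul_add_dotProduct (ha : 0 < a) (v : EReal) (p x : Fin K → ℝ) :
    (a : EReal) * (v + (((a⁻¹ • p) ⬝ᵥ x : ℝ) : EReal)) =
      (a : EReal) * v + ((p ⬝ᵥ x : ℝ) : EReal) := by
  rw [EReal.left_distrib_of_nonneg_of_ne_top (EReal.coe_nonneg.2 ha.le) (EReal.coe_ne_top a),
    ← EReal.coe_mul, smul_dotProduct, smul_eq_mul, mul_inv_cancel_left₀ ha.ne']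

theorem mul_le_mul_fenchelDual_add (ha : 0 < a) (hx : 0 ≤ x) (p : Fin K → ℝ) :
    (a : EReal) * u x ≤ (a : EReal) * fenchelDual u (a⁻¹ • p) + ((p ⬝ᵥ x : ℝ) : EReal) := by
  rw [← coe_mul_add_dotProduct ha]
  exact mul_le_mul_of_nonneg_left (le_fenchelDual_add_dotProduct hx) (EReal.coe_nonneg.2 ha.le)

theorem IsUtility.isSupported_inv_smul_iff (hu : IsUtility u) (ha : 0 < a)
    (hx : x ∈ effectiveDomain u) (p : Fin K → ℝ) :
    IsSupported u (a⁻¹ • p) x ↔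
      (a : EReal) * u x = (a : EReal) * fenchelDual u (a⁻¹ • p) + ((p ⬝ᵥ x : ℝ) : EReal) := by
  rw [← coe_mul_add_dotProduct ha, hu.isSupported_iff_eq_fenchelDual_add hx]
  exact (coe_mul_right_injective ha.ne').eq_iff.symm

end FenchelYoung

section Potential

variable {N K : ℕ} {u : Fin N → (Fin K → ℝ) → EReal} {α : Fin N → ℝ}
  {ω x x' : Fin N → Fin K → ℝ} {p p' w w' : Fin K → ℝ}

theorem sum_mul_fenchelDual_add :
    ∑ i, ((α i : EReal) * fenchelDual (u i) ((α i)⁻¹ • p) + ((p ⬝ᵥ x i : ℝ) : EReal)) =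
      dualWelfare u α p (∑ i, x i) := by
  rw [Finset.sum_add_distrib, ← coe_sum_ereal, ← dotProduct_sum, add_comm, dualWelfare]

theorem weightedUtility_le_dualWelfare_sum (hα : ∀ i, 0 < α i) (hx : ∀ i, 0 ≤ x i) :
    weightedUtility u α x ≤ dualWelfare u α p (∑ i, x i) :=
  (Finset.sum_le_sum fun i _ => mul_le_mul_fenchelDual_add (hα i) (hx i) p).trans_eq
    sum_mul_fenchelDual_add

theorem dotProduct_sum_le_of_mem_feasible (hx : x ∈ feasible w) (hp : 0 ≤ p) :
    p ⬝ᵥ ∑ i, x i ≤ p ⬝ᵥ w :=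
  dotProduct_le_dotProduct_of_nonneg_left
    (fun k => (Finset.sum_apply k _ x).trans_le (hx.2 k)) hp

theorem dualWelfare_sum_le (hx : x ∈ feasible w) (hp : 0 ≤ p) :
    dualWelfare u α p (∑ i, x i) ≤ dualWelfare u α p w :=
  add_le_add_left (EReal.coe_le_coe (dotProduct_sum_le_of_mem_feasible hx hp)) _

theorem dotProduct_eq_of_dualWelfare_eq (h : dualWelfare u α p w = dualWelfare u α p w')
    (hbot : dualWelfare u α p w ≠ ⊥) (htop : dualWelfare u α p w ≠ ⊤) :
    p ⬝ᵥ w = p ⬝ᵥ w' := by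
  rw [dualWelfare, EReal.add_ne_bot_iff] at hbot
  have hsum_top := (EReal.add_ne_top_iff_ne_top_right (EReal.coe_ne_bot _) (EReal.coe_ne_top _)).1
    htop
  rw [dualWelfare, dualWelfare] at h
  lift ∑ i, (α i : EReal) * fenchelDual (u i) ((α i)⁻¹ • p) to ℝ using ⟨hsum_top, hbot.2⟩ with s
  exact add_right_cancel (EReal.coe_injective h)

theorem weightedUtility_eq_coe (hu : ∀ i, IsUtility (u i))
    (hx : ∀ i, x i ∈ effectiveDomain (u i)) :
    weightedUtility u α x = ((∑ i, α i * (u i (x i)).toReal : ℝ) : EReal) := by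
  simp only [weightedUtility, coe_sum_ereal, EReal.coe_mul, (hu _).coe_toReal (hx _)]

theorem weightedUtility_eq_dualWelfare_sum_iff (hu : ∀ i, IsUtility (u i)) (hα : ∀ i, 0 < α i)
    (hx : ∀ i, x i ∈ effectiveDomain (u i)) :
    weightedUtility u α x = dualWelfare u α p (∑ i, x i) ↔
      ∀ i, IsSupported (u i) ((α i)⁻¹ • p) (x i) := by
  have hcoe := weightedUtility_eq_coe (α := α) hu hx
  simp only [(hu _).isSupported_inv_smul_iff (hα _) (hx _)]
  rw [← sum_mul_fenchelDual_add]
  exact ⟨fun h i => eq_of_sum_eq_of_forall_le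
    (fun i _ => mul_le_mul_fenchelDual_add (hα i) (hx i).1 p) h
    (hcoe.trans_ne (EReal.coe_ne_bot _)) (hcoe.trans_ne (EReal.coe_ne_top _)) (Finset.mem_univ i),
    fun h => Finset.sum_congr rfl fun i _ => h i⟩

theorem mem_effectiveDomain_of_weightedUtility_ne_bot (hα : ∀ i, 0 < α i) (hx : ∀ i, 0 ≤ x i)
    (h : weightedUtility u α x ≠ ⊥) (i : Fin N) : x i ∈ effectiveDomain (u i) :=
  ⟨hx i, bot_lt_iff_ne_bot.2 fun hi => ne_bot_of_sum_ne_bot h (Finset.mem_univ i)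
    (hi ▸ EReal.coe_mul_bot_of_pos (hα i))⟩

theorem isPotentialRoot_iff (hu : ∀ i, IsUtility (u i)) (hα : ∀ i, 0 < α i) :
    IsPotentialRoot u α w x p ↔ x ∈ feasible w ∧ 0 ≤ p ∧
      (∀ i, IsSupported (u i) ((α i)⁻¹ • p) (x i)) ∧ p ⬝ᵥ ∑ i, x i = p ⬝ᵥ w := by
  refine and_congr_right fun hx => and_congr_right fun hp => ?_
  rw [potential, ereal_sub_eq_zero_iff]
  constructor
  · rintro ⟨heq, hbot, htop⟩
    have hsum : weightedUtility u α x = dualWelfare u α p (∑ i, x i) :=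
      (weightedUtility_le_dualWelfare_sum hα hx.1).antisymm
        ((dualWelfare_sum_le hx hp).trans_eq heq.symm)
    exact ⟨(weightedUtility_eq_dualWelfare_sum_iff hu hα
      (mem_effectiveDomain_of_weightedUtility_ne_bot hα hx.1 hbot)).1 hsum,
      dotProduct_eq_of_dualWelfare_eq (hsum.symm.trans heq) (hsum ▸ hbot) (hsum ▸ htop)⟩
  · rintro ⟨hs, hval⟩
    have hcoe := weightedUtility_eq_coe (α := α) hu fun i => (hs i).mem
    refine ⟨?_, hcoe.trans_ne (EReal.coe_ne_bot _), hcoe.trans_ne (EReal.coe_ne_top _)⟩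
    rw [(weightedUtility_eq_dualWelfare_sum_iff hu hα fun i => (hs i).mem).2 hs, dualWelfare,
      hval, dualWelfare]

theorem weightedUtility_le_dualWelfare (hα : ∀ i, 0 < α i) (hx : x ∈ feasible w) (hp : 0 ≤ p) :
    weightedUtility u α x ≤ dualWelfare u α p w :=
  (weightedUtility_le_dualWelfare_sum hα hx.1).trans (dualWelfare_sum_le hx hp)

theorem IsPotentialRoot.swap (hα : ∀ i, 0 < α i) (h : IsPotentialRoot u α w x p)
    (h' : IsPotentialRoot u α w x' p') : IsPotentialRoot u α w x' p := by
  obtain ⟨hx, hp, hroot⟩ := h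
  obtain ⟨hx', hp', hroot'⟩ := h'
  have hval := (ereal_sub_eq_zero_iff.1 hroot).1
  have hval' := (ereal_sub_eq_zero_iff.1 hroot').1
  have hdual : dualWelfare u α p w = dualWelfare u α p' w := le_antisymm
    (hval ▸ weightedUtility_le_dualWelfare hα hx hp')
    (hval' ▸ weightedUtility_le_dualWelfare hα hx' hp)
  exact ⟨hx', hp, by rw [potential, hdual]; exact hroot'⟩

theorem IsPotentialRoot.sum_eq [NeZero N] (hu : ∀ i, IsUtility (u i)) (hα : ∀ i, 0 < α i)
    (h : IsPotentialRoot u α w x p) : ∑ i, x i = w := by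
  obtain ⟨hx, -, hs, hval⟩ := (isPotentialRoot_iff hu hα).1 h
  exact eq_of_le_of_dotProduct_eq
    (fun k => pos_of_mul_pos_right ((hs 0).price_pos (hu 0) k) (inv_pos.2 (hα 0)).le)
    (fun k => (Finset.sum_apply k _ x).trans_le (hx.2 k)) hval

theorem IsPotentialRoot.allocation_unique (hu : ∀ i, IsUtility (u i)) (hα : ∀ i, 0 < α i)
    (h : IsPotentialRoot u α w x p) (h' : IsPotentialRoot u α w x' p') : x' = x :=
  funext fun i => (((isPotentialRoot_iff hu hα).1 (h.swap hα h')).2.2.1 i).unique (hu i)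
    (((isPotentialRoot_iff hu hα).1 h).2.2.1 i)

theorem IsPotentialRoot.price_unique [NeZero N] (hu : ∀ i, IsUtility (u i)) (hα : ∀ i, 0 < α i)
    (hw : ∀ k, 0 < w k) (h : IsPotentialRoot u α w x p) (h' : IsPotentialRoot u α w x p') :
    p' = p := by
  obtain ⟨-, -, hs, -⟩ := (isPotentialRoot_iff hu hα).1 h
  obtain ⟨-, -, hs', -⟩ := (isPotentialRoot_iff hu hα).1 h'
  funext k
  obtain ⟨i, hi⟩ : ∃ i, 0 < x i k := by
    by_contra! hle
    refine (hw k).not_ge ?_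
    rw [← h.sum_eq hu hα, Finset.sum_apply]
    exact Finset.sum_nonpos fun i _ => hle i
  exact mul_left_cancel₀ (inv_pos.2 (hα i)).ne' <|
    ((hs' i).price_eq_deriv (hu i) hi).trans ((hs i).price_eq_deriv (hu i) hi).symm

theorem IsPotentialRoot.unique [NeZero N] (hu : ∀ i, IsUtility (u i)) (hα : ∀ i, 0 < α i)
    (hw : ∀ k, 0 < w k) (h : IsPotentialRoot u α w x p) (h' : IsPotentialRoot u α w x' p') :
    x' = x ∧ p' = p := by
  obtain rfl := h.allocation_unique hu hα h'
  exact ⟨rfl, h.price_unique hu hα hw h'⟩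

theorem IsWalrasianEquilibrium.exists_isPotentialRoot [NeZero N] (hu : ∀ i, IsUtility (u i))
    (hω : ∀ i k, 0 < ω i k) (h : IsWalrasianEquilibrium u ω x p) :
    ∃ α ∈ stdSimplex ℝ (Fin N), (∀ i, 0 < α i) ∧
      ∃ t : ℝ, 0 < t ∧ IsPotentialRoot u α (totalEndowment ω) x (t • p) := by
  choose l hl hs using fun i => (h.isDemand i).exists_isSupported (hu i) (hω i)
  -- Negishi's weights are inversely proportional to the marginal utilities of income `l i`;
  -- normalizing their sum rescales the prices.
  have hsum : 0 < ∑ i, (l i)⁻¹ :=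
    Finset.sum_pos (fun i _ => inv_pos.2 (hl i)) Finset.univ_nonempty
  have hα : ∀ i, 0 < (l i)⁻¹ / ∑ i, (l i)⁻¹ := fun i => div_pos (inv_pos.2 (hl i)) hsum
  refine ⟨fun i => (l i)⁻¹ / ∑ i, (l i)⁻¹, ⟨fun i => (hα i).le, ?_⟩, hα, (∑ i, (l i)⁻¹)⁻¹,
    inv_pos.2 hsum, (isPotentialRoot_iff hu hα).2 ⟨⟨h.bundle_nonneg, fun k => ?_⟩,
      smul_nonneg (inv_pos.2 hsum).le h.price_nonneg, fun i => ?_, ?_⟩⟩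
  · rw [← Finset.sum_div, div_self hsum.ne']
  · rw [← h.market_clearing, Finset.sum_apply]
  · rw [smul_smul, inv_div, div_inv_eq_mul, mul_right_comm, mul_inv_cancel₀ hsum.ne', one_mul]
    exact hs i
  · rw [h.market_clearing]

end Potential

theorem corollary3 {N K : ℕ} (hN : 0 < N)
    (u : Fin N → (Fin K → ℝ) → EReal) (hu : ∀ i, IsUtility (u i))
    (ω : Fin N → Fin K → ℝ) (hω : ∀ i k, 0 < ω i k) :
    ∃ α ∈ stdSimplex ℝ (Fin N), (∀ i, 0 < α i) ∧
      ∃ (x : Fin N → Fin K → ℝ) (p : Fin K → ℝ),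
        IsPotentialRoot u α (totalEndowment ω) x p ∧
        (∀ x' p', IsPotentialRoot u α (totalEndowment ω) x' p' → x' = x ∧ p' = p) ∧
        IsWalrasianEquilibrium u ω x p := by
  have : NeZero N := ⟨hN.ne'⟩
  obtain ⟨x, p, hequil⟩ := exists_isWalrasianEquilibrium hu hω
  obtain ⟨α, hα_mem, hα, t, ht, hroot⟩ := hequil.exists_isPotentialRoot hu hω
  exact ⟨α, hα_mem, hα, x, t • p, hroot,
    fun x' p' h => hroot.unique hu hα (totalEndowment_pos hω) h, hequil.smul ht⟩
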